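/- Identify finite binary strings with natural numbers through the length-lexicographic enumeration of strings ($\lambda\mapsto 0$, $0\mapsto 1$, $1\mapsto 2$, $00\mapsto 3,\dots$), and write $|x|$ for the length of a string $x$. A prefix-free machine is a partial computable function $T:2^{<\omega}\to 2^{<\omega}$ whose domain contains no two distinct strings one of which is a prefix of the other; put $C_T(x)=\min\{|y| : T(y)=x\}$ (with $\min\emptyset=\infty$). Let $\mathbb U$ be any optimal prefix-free machine, i.e. a prefix-free machine such that for every prefix-free machine $T$ one has $C_{\mathbb U}\le C_T+O(1)$, and let $K=C_{\mathbb U}$ be prefix-free Kolmogorov complexity. Let $\alpha(n)=\min\{K(i) : i>n\}$ be Solovay's $\alpha$-function. For a non-decreasing unbounded function $f:\mathbb N\to\mathbb N$ with $f(n)=o(n)$ put $p_f=\max\{n : f(n)\ge n\}$ and $f^*(n)=\min\{k : f^{(k)}(n)\le p_f\}$, where $f^{(k)}$ is the $k$-th iterate of $f$. Theorem. The function $\alpha$ is non-decreasing, unbounded and satisfies $\alpha(n)=o(n)$, so that $\alpha^*$ is defined, and the function $A=K+\alpha^*:2^{<\omega}\to\mathbb N$ has the following properties: 1. $A$ is upper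 semicomputable, i.e. the predicate $A(x)\le k$ is computably enumerable, uniformly in $x$ and $k$. 2. For every partial computable function $f:2^{<\omega}\to 2^{<\omega}$ there is a constant $c_f$ such that $A(f(x))\le A(x)+c_f$ for every $x$ in the domain of $f$. 3. $\sum_{x\in 2^{<\omega}}2^{-A(x)}<\infty$. 4. There is a constant $c$ such that $A(x)\le |x|+A(|x|)+c$ for all $x\in 2^{<\omega}$. 5. There is a constant $c$ such that $|\{x : |x|=n,\ A(x)\le n+A(n)-b\}|\le c\cdot 2^{n-b}$ for all $n\in\mathbb N$ and $b\in\mathbb Z$. 6. $|A-K|$ is not bounded. In particular, properties 1-5 of a function $A$ do not imply $A=K+O(1)$, i.e. they do not characterize prefix-free complexity. -/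

import Mathlib

open Filter

noncomputable section

/-- The number attached to a finite binary string (most significant bit first) by the
length-lexicographic enumeration of strings: `[] ↦ 0`, `[0] ↦ 1`, `[1] ↦ 2`, `[0,0] ↦ 3`, … -/
def natOfStr (x : List Bool) : ℕ :=
  x.foldl (fun n b => 2 * n + 1 + b.toNat) 0

/-- The `n`-th finite binary string in the length-lexicographic enumeration. -/
def strOfNat : ℕ → List Bool
  | 0 => []
  | n + 1 => strOfNat (n / 2) ++ [decide (n % 2 = 1)]
decreasing_by omega

theorem natOfStr_append (x : List Bool) (b : Bool) :
    natOfStr (x ++ [b]) = 2 * natOfStr x + 1 + b.toNat := by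
  simp [natOfStr]

theorem natOfStr_strOfNat (n : ℕ) : natOfStr (strOfNat n) = n := by
  induction n using Nat.strong_induction_on with
  | _ n ih =>
    cases n with
    | zero => simp [strOfNat, natOfStr]
    | succ n =>
      rw [strOfNat, natOfStr_append, ih (n / 2) (by omega)]
      rcases Nat.mod_two_eq_zero_or_one n with h | h <;> simp [h] <;> omega

theorem strOfNat_natOfStr (x : List Bool) : strOfNat (natOfStr x) = x := by
  induction x using List.reverseRecOn with
  | nil => simp [strOfNat, natOfStr]
  | append_singleton x b ih =>
    have h : natOfStr (x ++ [b]) = (2 * natOfStr x + b.toNat) + 1 := by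
      rw [natOfStr_append]; omega
    rw [h, strOfNat]
    cases b
    · simp [ih]
    · have h1 : (2 * natOfStr x + 1) / 2 = natOfStr x := by omega
      simp [h1, ih]

/-- The identification of finite binary strings with natural numbers. -/
def strEquivNat : List Bool ≃ ℕ where
  toFun := natOfStr
  invFun := strOfNat
  left_inv := strOfNat_natOfStr
  right_inv := natOfStr_strOfNat

/-- `C_T(x)`, the length of a shortest description of `x` for the machine `T`
(`⊤` if `x` has no description). -/
def machineComplexity (T : List Bool →. List Bool) (x : List Bool) : ℕ∞ :=
  ⨅ (y : List Bool) (_ : x ∈ T y), (y.length : ℕ∞)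

/-- `T` is a prefix-free machine: a partial computable function on strings, no two distinct
elements of whose domain are comparable for the prefix relation. -/
structure IsPrefixFreeMachine (T : List Bool →. List Bool) : Prop where
  partrec : Partrec T
  prefixFree : ∀ y z : List Bool, (T y).Dom → (T z).Dom → y <+: z → y = z

/-- `U` is an optimal prefix-free machine. -/
structure IsOptimalPrefixFreeMachine (U : List Bool →. List Bool) : Prop
    extends IsPrefixFreeMachine U where
  optimal : ∀ T : List Bool →. List Bool, IsPrefixFreeMachine T →
    ∃ c : ℕ, ∀ x : List Bool, machineComplexity U x ≤ machineComplexity T x + c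

/-- Every string has a description for an optimal prefix-free machine. -/
theorem IsOptimalPrefixFreeMachine.machineComplexity_ne_top {U : List Bool →. List Bool}
    (hU : IsOptimalPrefixFreeMachine U) (x : List Bool) : machineComplexity U x ≠ ⊤ := by
  let T : List Bool →. List Bool :=
    fun y => ((if y = [] then some x else none : Option (List Bool)) : Part (List Bool))
  have hdom : ∀ y, (T y).Dom → y = [] := by
    intro y hy
    by_contra h
    simp [T, h] at hy
  have hT : IsPrefixFreeMachine T := by
    refine ⟨?_, fun y z hy hz _ => by rw [hdom y hy, hdom z hz]⟩
    refine Computable.ofOption (f := fun y : List Bool => if y = [] then some x else none) ?_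
    exact (Primrec.ite (Primrec.eq.comp Primrec.id (Primrec.const []))
      (Primrec.const (some x)) (Primrec.const none)).to_comp
  obtain ⟨c, hc⟩ := hU.optimal T hT
  have h0 : machineComplexity T x ≤ 0 :=
    iInf₂_le_of_le [] (by simp [T]) (by simp)
  have h1 : machineComplexity U x ≤ (c : ℕ∞) :=
    (hc x).trans (by simpa using add_le_add_left h0 (c : ℕ∞))
  exact ne_top_of_le_ne_top (ENat.natCast_ne_top c) h1

/-- Prefix-free complexity `K(x)` relative to the machine `U`, as a natural number.
For an optimal `U` the complexity is always finite. -/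
def prefixComplexity (U : List Bool →. List Bool) (x : List Bool) : ℕ :=
  (machineComplexity U x).toNat

theorem IsOptimalPrefixFreeMachine.coe_prefixComplexity {U : List Bool →. List Bool}
    (hU : IsOptimalPrefixFreeMachine U) (x : List Bool) :
    (prefixComplexity U x : ℕ∞) = machineComplexity U x :=
  ENat.natCast_toNat (hU.machineComplexity_ne_top x)

/-- Solovay's function `α(n) = min {K(i) | i > n}`. -/
def solovayAlpha (U : List Bool →. List Bool) (n : ℕ) : ℕ :=
  sInf {m : ℕ | ∃ i : ℕ, n < i ∧ m = prefixComplexity U (strEquivNat.symm i)}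

/-- `f` is an order: a non-decreasing unbounded function. -/
def IsOrder (f : ℕ → ℕ) : Prop :=
  Monotone f ∧ ∀ m : ℕ, ∃ n : ℕ, m < f n

/-- `f` is sub-linear: `f(n) = o(n)`. -/
def IsSublinear (f : ℕ → ℕ) : Prop :=
  (fun n => (f n : ℝ)) =o[atTop] (fun n : ℕ => (n : ℝ))

/-- `p_f = max {n | f(n) ≥ n}`; the maximum exists if `f` is sub-linear. -/
def starThreshold (f : ℕ → ℕ) : ℕ :=
  sSup {n : ℕ | n ≤ f n}

/-- The star-operator `f^*(n) = min {k | f^{(k)}(n) ≤ p_f}`, for sub-linear orders `f`. -/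
def starOp (f : ℕ → ℕ) (n : ℕ) : ℕ :=
  sInf {k : ℕ | f^[k] n ≤ starThreshold f}

/-- The function `A = K + α^*` on strings. -/
def slowedComplexity (U : List Bool →. List Bool) (x : List Bool) : ℕ :=
  prefixComplexity U x + starOp (solovayAlpha U) (strEquivNat x)

/-- `A` is upper semicomputable: the predicate `A(x) ≤ k` is computably enumerable,
uniformly in `x` and `k`. -/
def UpperSemicomputable (A : List Bool → ℕ) : Prop :=
  REPred (fun p : List Bool × ℕ => A p.1 ≤ p.2)

/-- `A` is stable: no partial computable function increases it by more than a constant. -/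
def StableUnderPartialComputable (A : List Bool → ℕ) : Prop :=
  ∀ f : List Bool →. List Bool, Partrec f →
    ∃ c : ℕ, ∀ x y : List Bool, y ∈ f x → A y ≤ A x + c

end

/-!
Write `α` for Solovay's function and `A = K + α^*`.

The correction `α^*` is monotone and so slowly growing that it does not disturb the properties of
`K`, although it is unbounded because all iterates of the order `α` are unbounded. The key estimate
is `starOp_solovayAlpha_le`: if `z < g(x)` for a partial computable `g`, then
`α(z) ≤ K(g(x)) ≤ K(x) + O(1)`. Since `K(x) = O(log x)`, the right-hand side is at most `x` for large
`x`, and applying `α^*` gives `α^*(z) ≤ α^*(x) + O(1)`. Together with the corresponding facts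
about `K` this yields stability (with `g = f` followed by an appended bit) and the upper bound
`A(x) ≤ |x| + A(|x|) + O(1)` (with `g(n) = 0^{n+1}`). The lower bounds on `A` come from those
on `K`: `A ≥ K` gives summability, and since `α^*(x) ≥ α^*(|x|)` the counting property of `A` reduces to
that of `K`.
Upper semicomputability holds because `α^*(n) ≤ k` means `α^{(k)}(n) ≤ p_α`, and `α` has a
computable approximation from above (`alphaStage`), which may be iterated since `α` is monotone.

The upper bounds on `K` that do not come from composing machines follow from the Kraft–Chaitin
theorem (`prefixComplexity_le_of_requests`): an effectively enumerable set of requests `(x, r)` with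
`∑ 2^{-r} < ∞` satisfies `K(x) ≤ r + O(1)` for all its members. It is proved by placing the requests
side by side in the unit interval; an interval of length `2^{-r}` contains an aligned dyadic interval
of length `2^{-(r+1)}`, which serves as the program. Chaitin's counting theorem
(`ncard_mul_two_pow_le`) is the application of it to the probabilities that the universal machine
outputs a string of a given length.
-/

noncomputable section

open scoped ENNReal

/-! ### Binary strings as numbers -/

/-- Appending `w` to `y` multiplies the binary number `1y = natOfStr y + 1` by `2 ^ |w|`
and adds a number below `2 ^ |w|`. -/
theorem natOfStr_append_bounds (y w : List Bool) :
    2 ^ w.length * (natOfStr y + 1) ≤ natOfStr (y ++ w) + 1 ∧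
      natOfStr (y ++ w) + 1 < 2 ^ w.length * (natOfStr y + 2) := by
  induction w using List.reverseRecOn with
  | nil => simp
  | append_singleton w b ih =>
    rw [← List.append_assoc, natOfStr_append, List.length_append, List.length_singleton, pow_succ]
    cases b <;> simp <;> constructor <;> nlinarith [ih.1, ih.2]

theorem two_pow_length_le (x : List Bool) : 2 ^ x.length ≤ natOfStr x + 1 := by
  simpa [natOfStr] using (natOfStr_append_bounds [] x).1

theorem lt_two_pow_length (x : List Bool) : natOfStr x + 1 < 2 ^ (x.length + 1) := by
  have h := (natOfStr_append_bounds [] x).2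
  have h0 : natOfStr [] = 0 := rfl
  simp only [List.nil_append, h0] at h
  rw [pow_succ]
  omega

theorem natOfStr_injective : Function.Injective natOfStr := strEquivNat.injective

theorem length_le_natOfStr (x : List Bool) : x.length ≤ natOfStr x := by
  have h1 := two_pow_length_le x
  have h2 : x.length < 2 ^ x.length := Nat.lt_two_pow_self
  omega

theorem length_eq_of_natOfStr {x : List Bool} {n : ℕ} (h1 : 2 ^ n ≤ natOfStr x + 1)
    (h2 : natOfStr x + 1 < 2 ^ (n + 1)) : x.length = n := by
  have h3 := two_pow_length_le x
  have h4 := lt_two_pow_length x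
  have h5 : n < x.length + 1 := (Nat.pow_lt_pow_iff_right (by norm_num)).1 (h1.trans_lt h4)
  have h6 : x.length < n + 1 := (Nat.pow_lt_pow_iff_right (by norm_num)).1 (h3.trans_lt h2)
  omega

/-! ### Primitive recursive stages of partial computable functions -/

theorem Primrec.two_pow : Primrec (fun n : ℕ => 2 ^ n) :=
  (Primrec₂.unpaired'.1 Nat.Primrec.pow).comp (Primrec.const 2) Primrec.id

theorem primrec_natOfStr : Primrec natOfStr := by
  unfold natOfStr
  refine Primrec.list_foldl (α := List Bool) (h := fun _ p => 2 * p.1 + 1 + p.2.toNat)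
    Primrec.id (Primrec.const 0) ?_
  refine Primrec.nat_add.comp (Primrec.succ.comp (Primrec.nat_double.comp
    (Primrec.fst.comp Primrec.snd))) ((Primrec.dom_bool Bool.toNat).comp
    (Primrec.snd.comp Primrec.snd))

/-- A partial computable function is the increasing union of a uniformly primitive recursive
sequence of finite-stage approximations. -/
theorem Partrec.exists_stages {α σ : Type*} [Primcodable α] [Primcodable σ] {f : α →. σ}
    (hf : Partrec f) :
    ∃ u : ℕ → α → Option σ, Primrec₂ u ∧
      (∀ s t a b, s ≤ t → b ∈ u s a → b ∈ u t a) ∧ ∀ a b, b ∈ f a ↔ ∃ s, b ∈ u s a := by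
  obtain ⟨c, hc⟩ := Nat.Partrec.Code.exists_code.1 hf
  refine ⟨fun s a => (Nat.Partrec.Code.evaln s c (Encodable.encode a)).bind Encodable.decode,
    ?_, ?_, ?_⟩
  · refine Primrec.option_bind ?_ (Primrec.decode.comp Primrec.snd)
    exact Nat.Partrec.Code.primrec_evaln.comp
      (Primrec.pair (Primrec.pair Primrec.fst (Primrec.const c)) (Primrec.encode.comp Primrec.snd))
  · intro s t a b hst hb
    obtain ⟨n, hn, hb⟩ := Option.bind_eq_some_iff.1 hb
    exact Option.bind_eq_some_iff.2 ⟨n, Nat.Partrec.Code.evaln_mono hst hn, hb⟩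
  · intro a b
    have key : ∀ n, n ∈ Nat.Partrec.Code.eval c (Encodable.encode a) ↔
        ∃ b ∈ f a, Encodable.encode b = n := by
      intro n
      rw [hc]
      simp
    constructor
    · intro hb
      obtain ⟨s, hs⟩ := Nat.Partrec.Code.evaln_complete.1 ((key _).2 ⟨b, hb, rfl⟩)
      exact ⟨s, Option.bind_eq_some_iff.2 ⟨_, hs, Encodable.encodek b⟩⟩
    · rintro ⟨s, hs⟩
      obtain ⟨n, hn, hb⟩ := Option.bind_eq_some_iff.1 hs
      obtain ⟨b', hb', rfl⟩ := (key n).1 (Nat.Partrec.Code.evaln_sound hn)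
      rw [Encodable.encodek, Option.some_inj] at hb
      exact hb ▸ hb'

/-- `p` is the projection of a primitive recursive relation with witnesses in `ℕ`; this is a
normal form of computable enumerability. -/
def IsPrimrecProjection {α : Type*} [Primcodable α] (p : α → Prop) : Prop :=
  ∃ g : α → ℕ → Bool, Primrec₂ g ∧ ∀ a, p a ↔ ∃ n, g a n = true

/-- Witnesses may be taken from any primitively encodable type. -/
theorem IsPrimrecProjection.of_exists {α β : Type*} [Primcodable α] [Primcodable β]
    {p : α → Prop} {q : α → β → Prop} (hq : PrimrecRel q) (h : ∀ a, p a ↔ ∃ w, q a w) :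
    IsPrimrecProjection p := by
  classical
  refine ⟨fun a n => (((Encodable.decode n : Option β).map
    (fun w => decide (q a w))).getD false), ?_, ?_⟩
  · refine Primrec.option_getD.comp (Primrec.option_map (Primrec.decode.comp Primrec.snd) ?_)
      (Primrec.const false)
    exact hq.decide.comp (Primrec.fst.comp Primrec.fst) Primrec.snd
  · intro a
    rw [h a]
    constructor
    · rintro ⟨w, hw⟩
      exact ⟨Encodable.encode w, by simp [hw]⟩
    · rintro ⟨n, hn⟩
      rcases hd : (Encodable.decode n : Option β) with _ | w
      · simp [hd] at hn
      · exact ⟨w, by simpa [hd] using hn⟩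

theorem IsPrimrecProjection.rePred {α : Type*} [Primcodable α] {p : α → Prop}
    (hp : IsPrimrecProjection p) : REPred p := by
  obtain ⟨g, hg, h⟩ := hp
  have : Partrec fun a => Nat.rfind (fun n => Part.some (g a n)) :=
    Partrec.rfind hg.to_comp.partrec₂
  refine this.dom_re.of_eq fun a => ?_
  rw [h a]
  refine Nat.rfind_dom'.trans (exists_congr fun n => ?_)
  exact ⟨fun hn => (Part.mem_some_iff.1 hn.1).symm,
    fun hn => ⟨Part.mem_some_iff.2 hn.symm, fun _ => trivial⟩⟩

/-! ### Weights and the Kraft inequality -/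

/-- The weight `2 ^ (-n)` of a description of length `n`. -/
def weight (n : ℕ) : ℝ≥0∞ := 2⁻¹ ^ n

theorem weight_ne_top (n : ℕ) : weight n ≠ ⊤ := by simp [weight]

theorem weight_antitone : Antitone weight := fun _ _ h =>
  pow_le_pow_of_le_one (zero_le) (ENNReal.inv_le_one.2 (by norm_num)) h

theorem weight_add (m n : ℕ) : weight (m + n) = weight m * weight n := pow_add _ _ _

theorem weight_mul_two_pow (n : ℕ) : weight n * 2 ^ n = 1 := by
  rw [weight, ← mul_pow, ENNReal.inv_mul_cancel (by norm_num) (by norm_num), one_pow]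

theorem tsum_weight : ∑' n, weight n = 2 := by
  simp [weight, ENNReal.tsum_geometric]

theorem weight_toReal (n : ℕ) : (weight n).toReal = 2⁻¹ ^ n := by simp [weight]

theorem tsum_weight_tail (m : ℕ) : (∑' n, if m ≤ n then weight n else 0) = 2 * weight m := by
  have h : ∀ n ∉ Set.range (fun j : ℕ => m + j), (if m ≤ n then weight n else 0) = 0 := by
    intro n hn
    refine if_neg fun h => hn ⟨n - m, ?_⟩
    simp only
    omega
  rw [← (add_right_injective m).tsum_eq (f := fun n => if m ≤ n then weight n else 0)
    (fun n hn => by by_contra h'; exact hn (h n h'))]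
  simp [weight_add, ENNReal.tsum_mul_left, tsum_weight, mul_comm]

/-- There are `2 ^ n` strings of length `n`. -/
theorem tsum_ite_length (n : ℕ) (c : ℝ≥0∞) :
    (∑' x : List Bool, if x.length = n then c else 0) = 2 ^ n * c := by
  have h := tsum_subtype {x : List Bool | x.length = n} (fun _ => c)
  simp only [Set.indicator, Set.mem_ofPred_eq] at h
  rw [← h]
  change ∑' x : List.Vector Bool n, c = _
  rw [tsum_fintype]
  simp

theorem tsum_weight_length : ∑' x : List Bool, weight (2 * x.length) = 2 := by
  have h : ∀ x : List Bool,
      weight (2 * x.length) = ∑' n, if x.length = n then weight (2 * n) else 0 := by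
    intro x
    simp
  simp_rw [h]
  rw [ENNReal.tsum_comm, ← tsum_weight]
  refine tsum_congr fun n => ?_
  rw [tsum_ite_length, two_mul, weight_add, ← mul_assoc, mul_comm (2 ^ n), weight_mul_two_pow,
    one_mul]

theorem uniquelyDecodable_of_prefixFree {S : Set (List Bool)} (h0 : [] ∉ S)
    (h : ∀ y ∈ S, ∀ z ∈ S, y <+: z → y = z) : InformationTheory.UniquelyDecodable S := by
  intro L₁
  induction L₁ with
  | nil =>
    intro L₂ _ h2 he
    cases L₂ with
    | nil => rfl
    | cons z L₂ =>
      have : z = [] := by simp at he; exact he.1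
      exact absurd (h2 z (by simp)) (this ▸ h0)
  | cons y L₁ ih =>
    intro L₂ h1 h2 he
    cases L₂ with
    | nil =>
      have : y = [] := by simp at he; exact he.1
      exact absurd (h1 y (by simp)) (this ▸ h0)
    | cons z L₂ =>
      have hy := h1 y (by simp)
      have hz := h2 z (by simp)
      have hyz : y = z := by
        have p1 : y <+: (y :: L₁).flatten := by simp
        have p2 : z <+: (y :: L₁).flatten := by rw [he]; simp
        rcases List.prefix_or_prefix_of_prefix p1 p2 with p | p
        · exact h y hy z hz p
        · exact (h z hz y hy p).symm
      subst hyz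
      simp only [List.flatten_cons, List.append_cancel_left_eq] at he
      rw [ih L₂ (fun w hw => h1 w (by simp [hw])) (fun w hw => h2 w (by simp [hw])) he]

/-- Kraft's inequality for finite prefix-free sets. -/
theorem kraft_finset {S : Finset (List Bool)} (h : ∀ y ∈ S, ∀ z ∈ S, y <+: z → y = z) :
    ∑ w ∈ S, weight w.length ≤ 1 := by
  by_cases h0 : [] ∈ S
  · have : S = {[]} := Finset.eq_singleton_iff_unique_mem.2
      ⟨h0, fun z hz => (h [] h0 z hz (by simp)).symm⟩
    simp [this, weight]
  · have hk := InformationTheory.kraft_mcmillan_inequality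
      (uniquelyDecodable_of_prefixFree (S := (S : Set (List Bool))) (by simpa using h0)
        (by simpa using h))
    rw [← ENNReal.toReal_le_toReal (by simp [weight_ne_top]) (by simp),
      ENNReal.toReal_sum (by simp [weight_ne_top])]
    simpa [weight_toReal] using hk

/-- Kraft's inequality for the domain of a prefix-free machine. -/
theorem IsPrefixFreeMachine.kraft {T : List Bool →. List Bool} (hT : IsPrefixFreeMachine T) :
    ∑' y : {y // (T y).Dom}, weight y.1.length ≤ 1 := by
  rw [ENNReal.tsum_eq_iSup_sum]
  refine iSup_le fun F => ?_
  have h := kraft_finset (S := F.map (Function.Embedding.subtype _)) (by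
    simp only [Finset.mem_map]
    rintro _ ⟨y, -, rfl⟩ _ ⟨z, -, rfl⟩
    exact hT.prefixFree y z y.2 z.2)
  simpa using h

/-! ### Existence of short programs from effectively enumerated requests -/

/-- The total weight of the requests issued before time `t`, as a dyadic fraction: the pair
`(s, m)` stands for `s / 2 ^ m`. A request `(x, r)` asks for a program of length about `r`
for `x`. -/
def requestTotal (req : ℕ → Option (List Bool × ℕ)) (t : ℕ) : ℕ × ℕ :=
  Nat.rec (0, 0)
    (fun t s => (req t).elim s (fun a => (s.1 * 2 ^ a.2 + 2 ^ s.2, s.2 + a.2))) t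

/-- The number of the program serving a request of length `r` issued at time `t`. The program has
length `r + 1`, and its dyadic interval is the first one of that length whose left end exceeds
the total weight of the earlier requests. -/
def requestProgram (req : ℕ → Option (List Bool × ℕ)) (t r : ℕ) : ℕ :=
  2 ^ (r + 1) + (requestTotal req t).1 * 2 ^ (r + 1) / 2 ^ (requestTotal req t).2

/-- The weight of the request issued at time `t`. -/
def requestWeight (req : ℕ → Option (List Bool × ℕ)) (t : ℕ) : ℝ :=
  (req t).elim 0 (fun a => 2⁻¹ ^ a.2)

theorem primrec_requestTotal {req : ℕ → Option (List Bool × ℕ)} (hreq : Primrec req) :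
    Primrec (requestTotal req) := by
  refine Primrec.nat_rec₁ _ ?_
  have h : Primrec₂ fun (t : ℕ) (s : ℕ × ℕ) => Option.casesOn (motive := fun _ => ℕ × ℕ)
      (req t) s (fun a => (s.1 * 2 ^ a.2 + 2 ^ s.2, s.2 + a.2)) := by
    refine Primrec.option_casesOn (hreq.comp Primrec.fst) Primrec.snd ?_
    have hs : Primrec fun p : (ℕ × ℕ × ℕ) × (List Bool × ℕ) => p.1.2 :=
      Primrec.snd.comp Primrec.fst
    have hr : Primrec fun p : (ℕ × ℕ × ℕ) × (List Bool × ℕ) => p.2.2 :=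
      Primrec.snd.comp Primrec.snd
    exact Primrec.pair (Primrec.nat_add.comp
      (Primrec.nat_mul.comp (Primrec.fst.comp hs) (Primrec.two_pow.comp hr))
      (Primrec.two_pow.comp (Primrec.snd.comp hs)))
      (Primrec.nat_add.comp (Primrec.snd.comp hs) hr)
  exact h.of_eq fun t s => by cases req t <;> rfl

theorem primrec_requestProgram {req : ℕ → Option (List Bool × ℕ)} (hreq : Primrec req) :
    Primrec₂ (requestProgram req) := by
  have hs : Primrec fun p : ℕ × ℕ => requestTotal req p.1 :=
    (primrec_requestTotal hreq).comp Primrec.fst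
  have hp : Primrec fun p : ℕ × ℕ => 2 ^ (p.2 + 1) :=
    Primrec.two_pow.comp (Primrec.succ.comp Primrec.snd)
  exact Primrec.nat_add.comp hp (Primrec.nat_div.comp
    (Primrec.nat_mul.comp (Primrec.fst.comp hs) hp) (Primrec.two_pow.comp (Primrec.snd.comp hs)))

theorem requestTotal_div (req : ℕ → Option (List Bool × ℕ)) (t : ℕ) :
    ((requestTotal req t).1 : ℝ) / 2 ^ (requestTotal req t).2 =
      ∑ i ∈ Finset.range t, requestWeight req i := by
  induction t with
  | zero => simp [requestTotal]
  | succ t ih =>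
    have hs : requestTotal req (t + 1) = (req t).elim (requestTotal req t) (fun a =>
        ((requestTotal req t).1 * 2 ^ a.2 + 2 ^ (requestTotal req t).2,
          (requestTotal req t).2 + a.2)) := rfl
    rw [Finset.sum_range_succ, ← ih, hs, requestWeight]
    rcases req t with _ | a
    · simp
    · simp only [Option.elim_some, inv_pow]
      push_cast
      rw [pow_add]
      field_simp

/-- The dyadic interval of a program for a request lies between consecutive totals. -/
theorem requestProgram_bounds (req : ℕ → Option (List Bool × ℕ)) {t r : ℕ} {x : List Bool}
    (h : req t = some (x, r)) :
    (∑ i ∈ Finset.range t, requestWeight req i) * 2 ^ (r + 1) + 2 ^ (r + 1) ≤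
        (requestProgram req t r : ℝ) + 1 ∧
      (requestProgram req t r : ℝ) + 2 ≤
        (∑ i ∈ Finset.range (t + 1), requestWeight req i) * 2 ^ (r + 1) + 2 ^ (r + 1) := by
  have hw : requestWeight req t * 2 ^ (r + 1) = 2 := by
    simp only [requestWeight, h, Option.elim_some, inv_pow]
    rw [pow_succ]
    field_simp
  rw [Finset.sum_range_succ, add_mul, hw, ← requestTotal_div, requestProgram]
  set S := (requestTotal req t).1
  set M := (requestTotal req t).2
  have e : (S : ℝ) / 2 ^ M * 2 ^ (r + 1) = ((S * 2 ^ (r + 1) : ℕ) : ℝ) / ((2 ^ M : ℕ) : ℝ) := by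
    push_cast
    ring
  rw [e]
  have h1 := Nat.lt_floor_add_one (((S * 2 ^ (r + 1) : ℕ) : ℝ) / ((2 ^ M : ℕ) : ℝ))
  rw [Nat.floor_div_eq_div] at h1
  have h2 := Nat.cast_div_le (α := ℝ) (m := S * 2 ^ (r + 1)) (n := 2 ^ M)
  push_cast at h1 h2 ⊢
  constructor <;> linarith

theorem requestWeight_nonneg (req : ℕ → Option (List Bool × ℕ)) (t : ℕ) :
    0 ≤ requestWeight req t := by
  unfold requestWeight
  cases req t <;> simp

theorem requestProgram_length {req : ℕ → Option (List Bool × ℕ)}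
    (hsum : ∀ n, ∑ i ∈ Finset.range n, requestWeight req i ≤ 1) {t r : ℕ} {x y : List Bool}
    (h : req t = some (x, r)) (hy : natOfStr y = requestProgram req t r) :
    y.length = r + 1 := by
  have h2 := (requestProgram_bounds req h).2
  rw [← hy] at h2
  have h3 : (natOfStr y : ℝ) + 2 ≤ 2 ^ (r + 1 + 1) := by
    have := mul_le_mul_of_nonneg_right (hsum (t + 1)) (by positivity : (0 : ℝ) ≤ 2 ^ (r + 1))
    rw [pow_succ _ (r + 1)]
    linarith
  have h4 : natOfStr y + 2 ≤ 2 ^ (r + 1 + 1) := by exact_mod_cast h3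
  refine length_eq_of_natOfStr ?_ (by omega)
  rw [hy, requestProgram]
  exact (Nat.le_add_right _ _).trans (Nat.le_succ _)

/-- Programs serving requests issued at different times are incomparable. -/
theorem requestProgram_prefixFree {req : ℕ → Option (List Bool × ℕ)}
    (hsum : ∀ n, ∑ i ∈ Finset.range n, requestWeight req i ≤ 1) {t u r q : ℕ}
    {x x' y z : List Bool} (ht : req t = some (x, r)) (hu : req u = some (x', q))
    (hy : natOfStr y = requestProgram req t r) (hz : natOfStr z = requestProgram req u q)
    (hyz : y <+: z) : t = u := by
  obtain ⟨w, rfl⟩ := hyz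
  have ly := requestProgram_length hsum ht hy
  have lz := requestProgram_length hsum hu hz
  rw [List.length_append, ly] at lz
  obtain ⟨b1, b2⟩ := requestProgram_bounds req ht
  obtain ⟨c1, c2⟩ := requestProgram_bounds req hu
  rw [← hy] at b1 b2
  rw [← hz, ← lz, add_comm (r + 1), pow_add] at c1 c2
  obtain ⟨d1, d2⟩ := natOfStr_append_bounds y w
  have d1' : (2 : ℝ) ^ w.length * (natOfStr y + 1) ≤ natOfStr (y ++ w) + 1 := by exact_mod_cast d1
  have d2' : (natOfStr (y ++ w) : ℝ) + 1 < 2 ^ w.length * (natOfStr y + 2) := by exact_mod_cast d2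
  have hw : (0 : ℝ) < 2 ^ w.length := by positivity
  have hr : (0 : ℝ) < 2 ^ (r + 1) := by positivity
  have mono : ∀ {i j : ℕ}, i ≤ j → ∑ k ∈ Finset.range i, requestWeight req k ≤
      ∑ k ∈ Finset.range j, requestWeight req k := fun hij =>
    Finset.sum_le_sum_of_subset_of_nonneg (Finset.range_mono hij)
      fun k _ _ => requestWeight_nonneg req k
  by_contra hne
  rcases lt_or_gt_of_ne hne with hlt | hlt
  · have m := mul_le_mul_of_nonneg_left (mono (Nat.succ_le_of_lt hlt)) (mul_pos hw hr).le
    have b := mul_le_mul_of_nonneg_left b2 hw.le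
    rw [Nat.succ_eq_add_one] at m
    linarith
  · have m := mul_le_mul_of_nonneg_left (mono (Nat.succ_le_of_lt hlt)) (mul_pos hw hr).le
    have b := mul_le_mul_of_nonneg_left b1 hw.le
    rw [Nat.succ_eq_add_one] at m
    linarith

/-- The machine mapping the program of each request to the requested string. -/
def requestMachine (req : ℕ → Option (List Bool × ℕ)) : List Bool →. List Bool :=
  fun y => Nat.rfindOpt fun t => (req t).bind fun a =>
    if natOfStr y = requestProgram req t a.2 then some a.1 else none

theorem exists_of_mem_requestMachine {req : ℕ → Option (List Bool × ℕ)} {x y : List Bool}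
    (h : x ∈ requestMachine req y) :
    ∃ t r, req t = some (x, r) ∧ natOfStr y = requestProgram req t r := by
  obtain ⟨t, ht⟩ := Nat.rfindOpt_spec h
  obtain ⟨⟨x', r⟩, ha, hx⟩ := Option.bind_eq_some_iff.1 ht
  simp only [Option.ite_none_right_eq_some, Option.some_inj] at hx
  exact ⟨t, r, hx.2 ▸ ha, hx.1⟩

theorem isPrefixFreeMachine_requestMachine {req : ℕ → Option (List Bool × ℕ)}
    (hreq : Primrec req) (hsum : ∀ n, ∑ i ∈ Finset.range n, requestWeight req i ≤ 1) :
    IsPrefixFreeMachine (requestMachine req) := by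
  refine ⟨Partrec.rfindOpt (Primrec₂.to_comp ?_), ?_⟩
  · refine Primrec.option_bind (hreq.comp Primrec.snd) ?_
    refine Primrec.ite (Primrec.eq.comp ?_ ?_)
      (Primrec.option_some.comp (Primrec.fst.comp Primrec.snd)) (Primrec.const none)
    · exact primrec_natOfStr.comp (Primrec.fst.comp Primrec.fst)
    · exact (primrec_requestProgram hreq).comp (Primrec.snd.comp Primrec.fst)
        (Primrec.snd.comp Primrec.snd)
  · intro y z hy hz hyz
    obtain ⟨t, r, h1, h2⟩ := exists_of_mem_requestMachine (Part.get_mem hy)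
    obtain ⟨u, q, h3, h4⟩ := exists_of_mem_requestMachine (Part.get_mem hz)
    obtain rfl := requestProgram_prefixFree hsum h1 h3 h2 h4 hyz
    obtain rfl : r = q := by
      rw [h1, Option.some_inj, Prod.mk.injEq] at h3
      exact h3.2
    exact natOfStr_injective (h2.trans h4.symm)

theorem mem_requestMachine {req : ℕ → Option (List Bool × ℕ)}
    (hsum : ∀ n, ∑ i ∈ Finset.range n, requestWeight req i ≤ 1) {t r : ℕ} {x : List Bool}
    (h : req t = some (x, r)) : x ∈ requestMachine req (strOfNat (requestProgram req t r)) := by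
  set y := strOfNat (requestProgram req t r)
  have hy : natOfStr y = requestProgram req t r := natOfStr_strOfNat _
  have hd : (requestMachine req y).Dom := by
    refine Nat.rfindOpt_dom.2 ⟨t, x, ?_⟩
    simp [h, hy]
  obtain ⟨u, q, h3, h4⟩ := exists_of_mem_requestMachine (Part.get_mem hd)
  obtain rfl := requestProgram_prefixFree hsum h h3 hy h4 List.prefix_rfl
  rw [h, Option.some_inj, Prod.mk.injEq] at h3
  rw [h3.1]
  exact Part.get_mem hd

theorem IsOptimalPrefixFreeMachine.prefixComplexity_le_of_machine {U T : List Bool →. List Bool}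
    (hU : IsOptimalPrefixFreeMachine U) (hT : IsPrefixFreeMachine T) :
    ∃ c : ℕ, ∀ x y, x ∈ T y → prefixComplexity U x ≤ y.length + c := by
  obtain ⟨c, hc⟩ := hU.optimal T hT
  refine ⟨c, fun x y hxy => ?_⟩
  have h1 : machineComplexity T x ≤ y.length := iInf₂_le y hxy
  have h2 := (hc x).trans (add_le_add_left h1 (c : ℕ∞))
  rw [← hU.coe_prefixComplexity] at h2
  exact_mod_cast h2

/-- The Kraft–Chaitin theorem (existence of short programs): if the effectively enumerable set `R`
of requests has finite total weight, then each request `(x, r) ∈ R` is met up to an additive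
constant. -/
theorem IsOptimalPrefixFreeMachine.prefixComplexity_le_of_requests {U : List Bool →. List Bool}
    (hU : IsOptimalPrefixFreeMachine U) {R : List Bool × ℕ → Prop} (hR : IsPrimrecProjection R)
    (hsum : ∑' a : {a // R a}, weight a.1.2 ≠ ⊤) :
    ∃ c : ℕ, ∀ x r, R (x, r) → prefixComplexity U x ≤ r + c := by
  obtain ⟨g, hg, h⟩ := hR
  obtain ⟨N, hN⟩ := ENNReal.exists_nat_gt hsum
  have hN2 : ∑' a : {a // R a}, weight a.1.2 ≤ 2 ^ N :=
    hN.le.trans (by exact_mod_cast Nat.lt_two_pow_self.le)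
  -- A request is issued at the code of its least witness, so that it is issued only once;
  -- adding `N` to all lengths makes the total weight at most `1`.
  let first : (List Bool × ℕ) × ℕ → Prop := fun p => g p.1 p.2 = true ∧ ∀ e < p.2, g p.1 e ≠ true
  have hfirst : PrimrecPred first := by
    have hg' : PrimrecRel fun (e : ℕ) (a : List Bool × ℕ) => g a e ≠ true :=
      (Primrec.eq.comp (hg.comp Primrec.snd Primrec.fst) (Primrec.const true)).not
    exact (Primrec.eq.comp hg (Primrec.const true)).and
      ((hg'.forall_mem_list.comp (Primrec.list_range.comp Primrec.snd) Primrec.fst).of_eq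
        fun p => by simp)
  classical
  let req : ℕ → Option (List Bool × ℕ) := fun t =>
    (Encodable.decode₂ ((List Bool × ℕ) × ℕ) t).bind fun p =>
      if first p then some (p.1.1, p.1.2 + N) else none
  have hreq : Primrec req := by
    refine Primrec.option_bind Primrec.decode₂ ?_
    refine Primrec.ite (hfirst.comp Primrec.snd) (Primrec.option_some.comp ?_) (Primrec.const none)
    have h1 : Primrec fun p : ℕ × ((List Bool × ℕ) × ℕ) => p.2.1 := Primrec.fst.comp Primrec.snd
    exact Primrec.pair (Primrec.fst.comp h1)
      (Primrec.nat_add.comp (Primrec.snd.comp h1) (Primrec.const N))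
  have hreq_some : ∀ {t a}, req t = some a → ∃ p : (List Bool × ℕ) × ℕ,
      Encodable.encode p = t ∧ first p ∧ a = (p.1.1, p.1.2 + N) := by
    intro t a hta
    obtain ⟨p, hp, ha⟩ := Option.bind_eq_some_iff.1 hta
    simp only [Option.ite_none_right_eq_some, Option.some_inj] at ha
    exact ⟨p, Encodable.mem_decode₂.1 hp, ha.1, ha.2.symm⟩
  have hle : ∀ n, ∑ i ∈ Finset.range n, requestWeight req i ≤ 1 := by
    intro n
    have hterm : ∀ i, ENNReal.ofReal (requestWeight req i) ≤ ∑' a : {a // R a},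
        if req i = some (a.1.1, a.1.2 + N) then weight (a.1.2 + N) else 0 := by
      intro i
      rcases hi : req i with _ | b
      · simp [requestWeight, hi]
      · obtain ⟨p, -, hp, rfl⟩ := hreq_some hi
        refine le_trans (le_of_eq ?_) (ENNReal.le_tsum ⟨p.1, (h _).2 ⟨p.2, hp.1⟩⟩)
        rw [if_pos rfl, requestWeight, hi, Option.elim_some, ← weight_toReal,
          ENNReal.ofReal_toReal (weight_ne_top _)]
    have hinner : ∀ a : {a // R a},
        (∑' i, if req i = some (a.1.1, a.1.2 + N) then weight (a.1.2 + N) else 0) ≤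
          weight (a.1.2 + N) := by
      intro a
      have hex := (h _).1 a.2
      refine le_trans (ENNReal.tsum_le_tsum fun i => ?_)
        (tsum_ite_eq (Encodable.encode (a.1, Nat.find hex)) (fun _ => weight (a.1.2 + N))).le
      split_ifs with h1 h2 h2
      · exact le_rfl
      · refine absurd ?_ h2
        obtain ⟨⟨b, m⟩, rfl, hp, hb⟩ := hreq_some h1
        have hab : b = a.1 := by
          simp only [Prod.mk.injEq, Nat.add_right_cancel_iff] at hb
          exact Prod.ext hb.1.symm hb.2.symm
        subst hab
        rw [(Nat.find_eq_iff hex).2 ⟨hp.1, hp.2⟩]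
      · exact zero_le
      · exact le_rfl
    have htotal : ∑' i, ENNReal.ofReal (requestWeight req i) ≤ 1 := by
      refine (ENNReal.tsum_le_tsum hterm).trans ?_
      rw [ENNReal.tsum_comm]
      refine (ENNReal.tsum_le_tsum hinner).trans ?_
      simp_rw [weight_add, ENNReal.tsum_mul_right]
      rw [← weight_mul_two_pow N, mul_comm]
      gcongr
    have hfin := (ENNReal.sum_le_tsum (Finset.range n)).trans htotal
    rwa [← ENNReal.ofReal_sum_of_nonneg fun i _ => requestWeight_nonneg req i,
      ENNReal.ofReal_le_one] at hfin
  obtain ⟨c, hc⟩ := hU.prefixComplexity_le_of_machine (isPrefixFreeMachine_requestMachine hreq hle)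
  refine ⟨N + 1 + c, fun x r hxr => ?_⟩
  have hex := (h _).1 hxr
  have ht : req (Encodable.encode ((x, r), Nat.find hex)) = some (x, r + N) := by
    have : first ((x, r), Nat.find hex) := ⟨Nat.find_spec hex, fun e he => Nat.find_min hex he⟩
    change (Encodable.decode₂ _ (Encodable.encode _)).bind _ = _
    rw [Encodable.encodek₂, Option.bind_some, if_pos this]
  have := hc x _ (mem_requestMachine hle ht)
  rw [requestProgram_length hle ht (natOfStr_strOfNat _)] at this
  omega

/-! ### Prefix-free complexity -/

namespace IsOptimalPrefixFreeMachine

variable {U : List Bool →. List Bool}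

theorem prefixComplexity_le (hU : IsOptimalPrefixFreeMachine U) {x y : List Bool} (h : x ∈ U y) :
    prefixComplexity U x ≤ y.length := by
  have h1 : machineComplexity U x ≤ y.length := iInf₂_le y h
  rw [← hU.coe_prefixComplexity] at h1
  exact_mod_cast h1

theorem exists_program (hU : IsOptimalPrefixFreeMachine U) (x : List Bool) :
    ∃ y, x ∈ U y ∧ y.length = prefixComplexity U x := by
  have h1 : machineComplexity U x < ((prefixComplexity U x + 1 : ℕ) : ℕ∞) := by
    rw [← hU.coe_prefixComplexity]
    exact_mod_cast Nat.lt_succ_self _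
  obtain ⟨y, hy⟩ := iInf_lt_iff.1 h1
  obtain ⟨hxy, hlt⟩ := iInf_lt_iff.1 hy
  have hlt' : y.length < prefixComplexity U x + 1 := by exact_mod_cast hlt
  exact ⟨y, hxy, le_antisymm (Nat.lt_succ_iff.1 hlt') (hU.prefixComplexity_le hxy)⟩

theorem tsum_weight_prefixComplexity_le (hU : IsOptimalPrefixFreeMachine U) :
    ∑' x, weight (prefixComplexity U x) ≤ 1 := by
  choose p hp hl using hU.exists_program
  let e : List Bool → {y // (U y).Dom} := fun x => ⟨p x, Part.dom_iff_mem.2 ⟨x, hp x⟩⟩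
  have he : Function.Injective e := by
    intro x x' h
    have : p x = p x' := congrArg Subtype.val h
    exact Part.mem_unique (hp x) (this ▸ hp x')
  simp_rw [← hl]
  exact (ENNReal.tsum_comp_le_tsum_of_injective he (fun y => weight y.1.length)).trans
    hU.toIsPrefixFreeMachine.kraft

/-- Partial computable functions increase `K` by at most a constant. -/
theorem prefixComplexity_map_le (hU : IsOptimalPrefixFreeMachine U) {f : List Bool →. List Bool}
    (hf : Partrec f) :
    ∃ c : ℕ, ∀ x y, y ∈ f x → prefixComplexity U y ≤ prefixComplexity U x + c := by
  have hT : IsPrefixFreeMachine fun p => (U p).bind f :=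
    ⟨hU.partrec.bind (hf.comp Computable.snd).to₂,
      fun y z hy hz => hU.prefixFree y z hy.1 hz.1⟩
  obtain ⟨c, hc⟩ := hU.prefixComplexity_le_of_machine hT
  refine ⟨c, fun x y hxy => ?_⟩
  obtain ⟨p, hp, hl⟩ := hU.exists_program x
  rw [← hl]
  exact hc y p (Part.mem_bind hp hxy)

theorem tsum_requests (R : List Bool × ℕ → Prop) [DecidablePred R] :
    ∑' a : {a // R a}, weight a.1.2 = ∑' x, ∑' r, if R (x, r) then weight r else 0 := by
  have h := tsum_subtype {a | R a} (fun a => weight a.2)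
  simp only [Set.indicator, Set.mem_ofPred_eq] at h
  rw [← ENNReal.tsum_prod (f := fun x r => if R (x, r) then weight r else 0)]
  exact h

theorem prefixComplexity_le_two_mul_length (hU : IsOptimalPrefixFreeMachine U) :
    ∃ c : ℕ, ∀ x, prefixComplexity U x ≤ 2 * x.length + c := by
  have hR : IsPrimrecProjection fun a : List Bool × ℕ => a.2 = 2 * a.1.length :=
    .of_exists (β := ℕ) (q := fun a _ => a.2 = 2 * a.1.length)
      (Primrec.eq.comp (Primrec.snd.comp Primrec.fst) (Primrec.nat_double.comp
        (Primrec.list_length.comp (Primrec.fst.comp Primrec.fst)))) (by simp)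
  obtain ⟨c, hc⟩ := hU.prefixComplexity_le_of_requests hR (by
    rw [tsum_requests]
    simp [tsum_weight_length])
  exact ⟨c, fun x => hc x _ rfl⟩

theorem prefixComplexity_le_length_add (hU : IsOptimalPrefixFreeMachine U) :
    ∃ c : ℕ, ∀ x, prefixComplexity U x ≤
      x.length + prefixComplexity U (strEquivNat.symm x.length) + c := by
  classical
  obtain ⟨u, hu, -, hmem⟩ := hU.partrec.exists_stages
  let K := fun n => prefixComplexity U (strEquivNat.symm n)
  have hR : IsPrimrecProjection fun a : List Bool × ℕ =>
      a.1.length + K a.1.length ≤ a.2 := by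
    refine .of_exists (β := ℕ × List Bool) (q := fun a w =>
      (u w.1 w.2).map natOfStr = some a.1.length ∧ a.1.length + w.2.length ≤ a.2) ?_ ?_
    · have hl : Primrec fun p : (List Bool × ℕ) × (ℕ × List Bool) => p.1.1.length :=
        Primrec.list_length.comp (Primrec.fst.comp Primrec.fst)
      have hy : Primrec fun p : (List Bool × ℕ) × (ℕ × List Bool) => p.2.2 :=
        Primrec.snd.comp Primrec.snd
      refine PrimrecPred.and (Primrec.eq.comp (Primrec.option_map
        (hu.comp (Primrec.fst.comp Primrec.snd) hy) (primrec_natOfStr.comp Primrec.snd))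
        (Primrec.option_some.comp hl)) ?_
      exact Primrec.nat_le.comp (Primrec.nat_add.comp hl (Primrec.list_length.comp hy))
        (Primrec.snd.comp Primrec.fst)
    · rintro ⟨x, r⟩
      constructor
      · intro h
        obtain ⟨y, hy, hl⟩ := hU.exists_program (strEquivNat.symm x.length)
        obtain ⟨s, hs⟩ := (hmem _ _).1 hy
        refine ⟨(s, y), ?_, ?_⟩
        · rw [Option.mem_def.1 hs]
          exact congrArg some (strEquivNat.apply_symm_apply _)
        · rw [hl]; exact h
      · rintro ⟨⟨s, y⟩, h1, h2⟩
        obtain ⟨z, hz, hn⟩ := Option.map_eq_some_iff.1 h1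
        have : strEquivNat.symm x.length = z := by
          rw [Equiv.symm_apply_eq]; exact hn.symm
        have hk : prefixComplexity U z ≤ y.length := hU.prefixComplexity_le ((hmem _ _).2 ⟨s, hz⟩)
        simp only [K, this]
        simp only at h2
        omega
  obtain ⟨c, hc⟩ := hU.prefixComplexity_le_of_requests hR (by
    rw [tsum_requests]
    simp_rw [tsum_weight_tail, weight_add]
    have h : ∀ x : List Bool, 2 * (weight x.length * weight (K x.length)) =
        ∑' n, if x.length = n then 2 * (weight n * weight (K n)) else 0 := by
      intro x
      simp
    simp_rw [h]
    rw [ENNReal.tsum_comm]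
    have h2 : ∀ n, (∑' x : List Bool, if x.length = n then 2 * (weight n * weight (K n)) else 0) =
        2 * weight (K n) := by
      intro n
      rw [tsum_ite_length]
      calc (2 : ℝ≥0∞) ^ n * (2 * (weight n * weight (K n)))
          = weight n * 2 ^ n * (2 * weight (K n)) := by ring
        _ = _ := by rw [weight_mul_two_pow, one_mul]
    simp_rw [h2]
    rw [ENNReal.tsum_mul_left, strEquivNat.symm.tsum_eq fun x => weight (prefixComplexity U x)]
    exact ENNReal.mul_ne_top (by norm_num)
      (ne_top_of_le_ne_top ENNReal.one_ne_top hU.tsum_weight_prefixComplexity_le))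
  exact ⟨c, fun x => hc x _ le_rfl⟩

/-! ### Counting strings of given length and small complexity -/

/-- The codes `e < s` of programs of length at most `k` that are seen by stage `s` to output a
string of length `n`; here `p = (s, k, n)`. -/
def shortPrograms (u : ℕ → List Bool → Option (List Bool)) (p : ℕ × ℕ × ℕ) : List ℕ :=
  (List.range p.1).filter fun e => (Encodable.decode₂ (List Bool) e).bind
    (fun y => if y.length ≤ p.2.1 then (u p.1 y).map List.length else none) = some p.2.2

theorem primrec_shortPrograms {u : ℕ → List Bool → Option (List Bool)} (hu : Primrec₂ u) :
    Primrec (shortPrograms u) := by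
  have h : PrimrecRel fun (e : ℕ) (p : ℕ × ℕ × ℕ) => (Encodable.decode₂ (List Bool) e).bind
      (fun y => if y.length ≤ p.2.1 then (u p.1 y).map List.length else none) = some p.2.2 := by
    refine Primrec.eq.comp (Primrec.option_bind (Primrec.decode₂.comp Primrec.fst) ?_)
      (Primrec.option_some.comp (Primrec.snd.comp (Primrec.snd.comp Primrec.snd)))
    have hp : Primrec fun a : (ℕ × ℕ × ℕ × ℕ) × List Bool => a.1.2 :=
      Primrec.snd.comp Primrec.fst
    refine Primrec.ite (Primrec.nat_le.comp (Primrec.list_length.comp Primrec.snd)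
      (Primrec.fst.comp (Primrec.snd.comp hp))) ?_ (Primrec.const none)
    exact Primrec.option_map (hu.comp (Primrec.fst.comp hp) Primrec.snd)
      (Primrec.list_length.comp Primrec.snd)
  exact h.listFilter.comp (Primrec.list_range.comp Primrec.fst) Primrec.id

theorem mem_shortPrograms {u : ℕ → List Bool → Option (List Bool)} {s k n e : ℕ} :
    e ∈ shortPrograms u (s, k, n) ↔ e < s ∧ ∃ y z, Encodable.encode y = e ∧ y.length ≤ k ∧
      z ∈ u s y ∧ z.length = n := by
  simp only [shortPrograms, List.mem_filter, List.mem_range, decide_eq_true_eq,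
    Option.bind_eq_some_iff, Option.ite_none_right_eq_some, Option.map_eq_some_iff]
  refine and_congr_right fun _ => ⟨?_, ?_⟩
  · rintro ⟨y, hy, hl, z, hz, hn⟩
    exact ⟨y, z, Encodable.mem_decode₂.1 hy, hl, hz, hn⟩
  · rintro ⟨y, z, hy, hl, hz, hn⟩
    exact ⟨y, Encodable.mem_decode₂.2 hy, hl, z, hz, hn⟩

/-- The probability that the machine `U` outputs a string of length `n`. -/
def lengthProbability (U : List Bool →. List Bool) (n : ℕ) : ℝ≥0∞ :=
  ∑' y : {y // (U y).Dom}, if ((U y.1).get y.2).length = n then weight y.1.length else 0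

theorem tsum_lengthProbability_le (hU : IsOptimalPrefixFreeMachine U) :
    ∑' n, lengthProbability U n ≤ 1 := by
  unfold lengthProbability
  rw [ENNReal.tsum_comm]
  simpa using hU.toIsPrefixFreeMachine.kraft

theorem length_shortPrograms_mul_weight_le {u : ℕ → List Bool → Option (List Bool)}
    (hmem : ∀ y x, x ∈ U y ↔ ∃ s, x ∈ u s y) (s k n : ℕ) :
    (shortPrograms u (s, k, n)).length * weight k ≤ lengthProbability U n := by
  have hnd : (shortPrograms u (s, k, n)).Nodup := List.nodup_range.filter _
  rw [← List.toFinset_card_of_nodup hnd, ← nsmul_eq_mul, ← Finset.sum_const]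
  have hterm : ∀ e ∈ (shortPrograms u (s, k, n)).toFinset, weight k ≤
      ∑' y : {y // (U y).Dom}, if Encodable.encode y.1 = e then
        (if ((U y.1).get y.2).length = n then weight y.1.length else 0) else 0 := by
    intro e he
    obtain ⟨-, y, z, rfl, hl, hz, hn⟩ := mem_shortPrograms.1 (List.mem_toFinset.1 he)
    have hzy : z ∈ U y := (hmem _ _).2 ⟨s, hz⟩
    have hd : (U y).Dom := Part.dom_iff_mem.2 ⟨z, hzy⟩
    refine le_trans ?_ (ENNReal.le_tsum ⟨y, hd⟩)
    rw [if_pos rfl, if_pos (by rw [Part.get_eq_of_mem hzy hd, hn])]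
    exact weight_antitone hl
  refine (Finset.sum_le_sum hterm).trans ((ENNReal.sum_le_tsum _).trans ?_)
  rw [ENNReal.tsum_comm]
  simp [lengthProbability]

theorem ncard_le_length_shortPrograms (hU : IsOptimalPrefixFreeMachine U)
    {u : ℕ → List Bool → Option (List Bool)}
    (hmono : ∀ s t y x, s ≤ t → x ∈ u s y → x ∈ u t y)
    (hmem : ∀ y x, x ∈ U y ↔ ∃ s, x ∈ u s y) (k n : ℕ) :
    ∃ s, {x : List Bool | x.length = n ∧ prefixComplexity U x ≤ k}.ncard ≤
      (shortPrograms u (s, k, n)).length := by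
  have hfin : {x : List Bool | x.length = n ∧ prefixComplexity U x ≤ k}.Finite :=
    (List.finite_length_eq Bool n).subset fun x hx => hx.1
  obtain ⟨F, hF⟩ := hfin.exists_finset_coe
  rw [← hF, Set.ncard_coe_finset]
  choose p hp hl using hU.exists_program
  choose t ht using fun x => (hmem _ _).1 (hp x)
  let s := F.sup fun x => max (t x) (Encodable.encode (p x) + 1)
  have hs : ∀ x ∈ F, t x ≤ s ∧ Encodable.encode (p x) < s := fun x hx =>
    max_le_iff.1 (Finset.le_sup (f := fun x => max (t x) (Encodable.encode (p x) + 1)) hx)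
  refine ⟨s, ?_⟩
  refine le_trans ?_ (List.toFinset_card_le _)
  refine Finset.card_le_card_of_injOn (fun x => Encodable.encode (p x)) ?_ ?_
  · intro x hx
    have hx' : x.length = n ∧ prefixComplexity U x ≤ k := by
      have : x ∈ (F : Set (List Bool)) := hx
      rw [hF] at this
      exact this
    refine List.mem_toFinset.2 (mem_shortPrograms.2 ⟨(hs x hx).2, p x, x, rfl, ?_, ?_, hx'.1⟩)
    · rw [hl]; exact hx'.2
    · exact hmono _ _ _ _ (hs x hx).1 (ht x)
  · intro x _ x' _ h
    have : p x = p x' := Encodable.encode_injective h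
    exact Part.mem_unique (hp x) (this ▸ hp x')

theorem ncard_le_two_pow (hU : IsOptimalPrefixFreeMachine U) (n k : ℕ) :
    {x : List Bool | x.length = n ∧ prefixComplexity U x ≤ k}.ncard ≤ 2 ^ k := by
  have hfin : {x : List Bool | x.length = n ∧ prefixComplexity U x ≤ k}.Finite :=
    (List.finite_length_eq Bool n).subset fun x hx => hx.1
  obtain ⟨F, hF⟩ := hfin.exists_finset_coe
  rw [← hF, Set.ncard_coe_finset]
  have h1 : ∑ x ∈ F, weight k ≤ 1 := by
    refine le_trans (Finset.sum_le_sum fun x hx => ?_)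
      ((ENNReal.sum_le_tsum F).trans hU.tsum_weight_prefixComplexity_le)
    have : x ∈ (F : Set (List Bool)) := hx
    rw [hF] at this
    exact weight_antitone this.2
  rw [Finset.sum_const, nsmul_eq_mul] at h1
  have h2 : (F.card : ℝ≥0∞) ≤ 2 ^ k := by
    calc (F.card : ℝ≥0∞) = F.card * weight k * 2 ^ k := by
          rw [mul_assoc, weight_mul_two_pow, mul_one]
      _ ≤ 1 * 2 ^ k := by gcongr
      _ = 2 ^ k := one_mul _
  exact_mod_cast h2

/-- Chaitin's counting theorem: at most `2 ^ (k - K(n) + O(1))` strings of length `n` have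
complexity at most `k`. If there were `2 ^ (k - r)` of them, then a request of length `r` could be
issued for `n`, since `U` outputs a string of length `n` with probability at least `2 ^ (-r)`. -/
theorem ncard_mul_two_pow_le (hU : IsOptimalPrefixFreeMachine U) :
    ∃ c : ℕ, ∀ n k : ℕ, {x : List Bool | x.length = n ∧ prefixComplexity U x ≤ k}.ncard *
      2 ^ prefixComplexity U (strEquivNat.symm n) ≤ 2 ^ (k + c) := by
  classical
  obtain ⟨u, hu, hmono, hmem⟩ := hU.partrec.exists_stages
  let R : List Bool × ℕ → Prop := fun a => ∃ w : ℕ × ℕ,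
    2 ^ w.2 ≤ 2 ^ a.2 * (shortPrograms u (w.1, w.2, natOfStr a.1)).length
  have hR : IsPrimrecProjection R := by
    refine .of_exists (β := ℕ × ℕ) ?_ fun a => Iff.rfl
    have hk : Primrec fun p : (List Bool × ℕ) × (ℕ × ℕ) => p.2.2 := Primrec.snd.comp Primrec.snd
    refine Primrec.nat_le.comp (Primrec.two_pow.comp hk) (Primrec.nat_mul.comp
      (Primrec.two_pow.comp (Primrec.snd.comp Primrec.fst))
      (Primrec.list_length.comp ((primrec_shortPrograms hu).comp (Primrec.pair
        (Primrec.fst.comp Primrec.snd) (Primrec.pair hk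
        (primrec_natOfStr.comp (Primrec.fst.comp Primrec.fst)))))))
  have hRw : ∀ x r, R (x, r) → weight r ≤ lengthProbability U (natOfStr x) := by
    rintro x r ⟨⟨s, k⟩, hw⟩
    refine le_trans ?_ (length_shortPrograms_mul_weight_le hmem s k (natOfStr x))
    have hw' : (2 : ℝ≥0∞) ^ k ≤ 2 ^ r * (shortPrograms u (s, k, natOfStr x)).length := by
      exact_mod_cast hw
    calc weight r = weight r * weight k * 2 ^ k := by rw [mul_assoc, weight_mul_two_pow, mul_one]
      _ ≤ weight r * weight k * (2 ^ r * (shortPrograms u (s, k, natOfStr x)).length) := by gcongr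
      _ = weight r * 2 ^ r * ((shortPrograms u (s, k, natOfStr x)).length * weight k) := by ring
      _ = _ := by rw [weight_mul_two_pow, one_mul]
  have hinner : ∀ x, (∑' r, if R (x, r) then weight r else 0) ≤
      2 * lengthProbability U (natOfStr x) := by
    intro x
    by_cases hex : ∃ r, R (x, r)
    · calc (∑' r, if R (x, r) then weight r else 0)
          ≤ ∑' r, if Nat.find hex ≤ r then weight r else 0 := by
            refine ENNReal.tsum_le_tsum fun r => ?_
            split_ifs with h1 h2 h2
            · exact le_rfl
            · exact absurd (Nat.find_min' hex h1) h2
            · exact zero_le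
            · exact le_rfl
        _ = 2 * weight (Nat.find hex) := tsum_weight_tail _
        _ ≤ _ := by gcongr; exact hRw _ _ (Nat.find_spec hex)
    · rw [not_exists] at hex
      simp [hex]
  obtain ⟨c, hc⟩ := hU.prefixComplexity_le_of_requests hR (by
    rw [tsum_requests]
    refine ne_top_of_le_ne_top ?_ (ENNReal.tsum_le_tsum hinner)
    have he : ∑' x, lengthProbability U (natOfStr x) = ∑' n, lengthProbability U n :=
      strEquivNat.tsum_eq fun n => lengthProbability U n
    rw [ENNReal.tsum_mul_left, he]
    exact ENNReal.mul_ne_top (by norm_num)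
      (ne_top_of_le_ne_top ENNReal.one_ne_top hU.tsum_lengthProbability_le))
  refine ⟨c + 1, fun n k => ?_⟩
  obtain ⟨s, hs⟩ := hU.ncard_le_length_shortPrograms hmono hmem k n
  have hle := hU.ncard_le_two_pow n k
  set M := {x : List Bool | x.length = n ∧ prefixComplexity U x ≤ k}.ncard
  rcases Nat.eq_zero_or_pos M with h0 | hpos
  · simp [h0]
  have hex : ∃ r, 2 ^ k ≤ 2 ^ r * M := ⟨k, Nat.le_mul_of_pos_right _ hpos⟩
  have hr := Nat.find_spec hex
  have hmin : ∀ q < Nat.find hex, ¬ 2 ^ k ≤ 2 ^ q * M := fun q hq => Nat.find_min hex hq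
  set r := Nat.find hex
  have hK := hc (strEquivNat.symm n) r ⟨(s, k), by
    have : natOfStr (strEquivNat.symm n) = n := strEquivNat.apply_symm_apply n
    simp only [this]
    exact hr.trans (Nat.mul_le_mul_left _ hs)⟩
  have hM : M * 2 ^ r ≤ 2 ^ (k + 1) := by
    rcases Nat.eq_zero_or_pos r with h | h
    · rw [h, pow_succ]
      omega
    · have h1 := hmin (r - 1) (by omega)
      have h2 : 2 ^ r = 2 * 2 ^ (r - 1) := by
        rw [← pow_succ']
        congr 1
        omega
      rw [h2, pow_succ]
      nlinarith
  calc M * 2 ^ prefixComplexity U (strEquivNat.symm n) ≤ M * 2 ^ (r + c) := by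
        gcongr
        norm_num
    _ = M * 2 ^ r * 2 ^ c := by ring
    _ ≤ 2 ^ (k + 1) * 2 ^ c := by gcongr
    _ = 2 ^ (k + (c + 1)) := by ring

end IsOptimalPrefixFreeMachine

/-! ### The star operator -/

section Star

variable {f : ℕ → ℕ}

theorem bddAbove_of_isSublinear (hf : IsSublinear f) : BddAbove {n | n ≤ f n} := by
  obtain ⟨N, hN⟩ := eventually_atTop.1 (Asymptotics.isLittleO_iff.1 hf (c := 1 / 2) (by norm_num))
  refine ⟨N, fun n hn => ?_⟩
  by_contra h
  have h1 := hN n (by omega)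
  simp only [RCLike.norm_natCast] at h1
  have h2 : (n : ℝ) ≤ f n := by exact_mod_cast hn
  have h3 : (0 : ℝ) < n := by exact_mod_cast (by omega : 0 < n)
  linarith

theorem lt_of_starThreshold_lt (hf : IsSublinear f) {n : ℕ} (hn : starThreshold f < n) :
    f n < n := by
  have h := notMem_of_csSup_lt hn (bddAbove_of_isSublinear hf)
  exact not_le.1 h

theorem map_starThreshold_le (hm : Monotone f) (hf : IsSublinear f) :
    f (starThreshold f) ≤ starThreshold f :=
  Nat.lt_succ_iff.1 ((hm (Nat.le_succ _)).trans_lt (lt_of_starThreshold_lt hf (Nat.lt_succ_self _)))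

theorem exists_iterate_le_starThreshold (hf : IsSublinear f) (n : ℕ) :
    ∃ k, f^[k] n ≤ starThreshold f := by
  induction n using Nat.strong_induction_on with
  | _ n ih =>
    by_cases h : n ≤ starThreshold f
    · exact ⟨0, h⟩
    · obtain ⟨k, hk⟩ := ih (f n) (lt_of_starThreshold_lt hf (not_le.1 h))
      exact ⟨k + 1, hk⟩

theorem starOp_le_iff (hm : Monotone f) (hf : IsSublinear f) {n k : ℕ} :
    starOp f n ≤ k ↔ f^[k] n ≤ starThreshold f := by
  constructor
  · intro h
    induction k, h using Nat.le_induction with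
    | base => exact Nat.sInf_mem (exists_iterate_le_starThreshold hf n)
    | succ k _ ih =>
      rw [Function.iterate_succ_apply']
      exact (hm ih).trans (map_starThreshold_le hm hf)
  · exact fun h => Nat.sInf_le h

theorem starOp_mono (hm : Monotone f) (hf : IsSublinear f) : Monotone (starOp f) :=
  fun _ _ h => (starOp_le_iff hm hf).2 ((hm.iterate _ h).trans ((starOp_le_iff hm hf).1 le_rfl))

theorem starOp_le_succ (hm : Monotone f) (hf : IsSublinear f) (n : ℕ) :
    starOp f n ≤ starOp f (f n) + 1 := by
  have h : f^[starOp f (f n)] (f n) ≤ starThreshold f := (starOp_le_iff hm hf).1 le_rfl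
  exact (starOp_le_iff hm hf).2 h

theorem starOp_max_le (hm : Monotone f) (hf : IsSublinear f) (m n : ℕ) :
    starOp f (max m n) ≤ starOp f m + starOp f n := by
  rw [(starOp_mono hm hf).map_max]
  omega

theorem exists_lt_iterate (hf : IsOrder f) (k m : ℕ) : ∃ n, m < f^[k] n := by
  induction k with
  | zero => exact ⟨m + 1, Nat.lt_succ_self m⟩
  | succ k ih =>
    obtain ⟨n, hn⟩ := ih
    obtain ⟨i, hi⟩ := hf.2 n
    exact ⟨i, hn.trans_le (hf.1.iterate k hi.le)⟩

theorem exists_lt_starOp (hf : IsOrder f) (hs : IsSublinear f) (k : ℕ) : ∃ n, k < starOp f n := by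
  obtain ⟨n, hn⟩ := exists_lt_iterate hf k (starThreshold f)
  exact ⟨n, by rwa [← not_le, starOp_le_iff hf.1 hs, not_le]⟩

end Star

/-! ### Solovay's function -/

theorem sq_le_two_pow {l : ℕ} (hl : 4 ≤ l) : l ^ 2 ≤ 2 ^ l := by
  induction l, hl using Nat.le_induction with
  | base => norm_num
  | succ l hl ih =>
    rw [pow_succ 2 l]
    nlinarith

/-- The length of the `n`-th string is logarithmic in `n`, hence `o(n)`. -/
theorem exists_mul_length_le (m c : ℕ) :
    ∃ N, ∀ x : List Bool, N ≤ natOfStr x → m * (2 * x.length + c) ≤ natOfStr x := by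
  refine ⟨2 ^ (2 * m + m * c + 5), fun x hx => ?_⟩
  have h1 := two_pow_length_le x
  have h2 := lt_two_pow_length x
  have h3 : 2 * m + m * c + 5 < x.length + 1 :=
    (Nat.pow_lt_pow_iff_right (by norm_num)).1 ((by omega : _ < natOfStr x + 1).trans h2)
  have h4 := sq_le_two_pow (l := x.length) (by omega)
  have h5 : (2 * m + m * c + 1) * x.length ≤ x.length ^ 2 := by
    rw [sq]
    exact Nat.mul_le_mul_right _ (by omega)
  have h6 : m * c * 1 ≤ m * c * x.length := Nat.mul_le_mul_left _ (by omega)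
  have h7 : 1 ≤ x.length := by omega
  nlinarith

namespace IsOptimalPrefixFreeMachine

variable {U : List Bool →. List Bool}

theorem solovayAlpha_le {n : ℕ} {x : List Bool} (h : n < natOfStr x) :
    solovayAlpha U n ≤ prefixComplexity U x :=
  Nat.sInf_le ⟨natOfStr x, h, congrArg _ (strEquivNat.symm_apply_apply x).symm⟩

theorem exists_eq_solovayAlpha (U : List Bool →. List Bool) (n : ℕ) :
    ∃ x, n < natOfStr x ∧ prefixComplexity U x = solovayAlpha U n := by
  obtain ⟨i, hi, h⟩ := Nat.sInf_mem (s := {m : ℕ | ∃ i : ℕ, n < i ∧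
    m = prefixComplexity U (strEquivNat.symm i)}) ⟨_, n + 1, Nat.lt_succ_self n, rfl⟩
  refine ⟨strEquivNat.symm i, ?_, h.symm⟩
  change n < strEquivNat (strEquivNat.symm i)
  rwa [Equiv.apply_symm_apply]

theorem monotone_solovayAlpha (U : List Bool →. List Bool) : Monotone (solovayAlpha U) := by
  intro n m h
  obtain ⟨x, hx, he⟩ := exists_eq_solovayAlpha U m
  exact he ▸ solovayAlpha_le (h.trans_lt hx)

theorem finite_prefixComplexity_le (hU : IsOptimalPrefixFreeMachine U) (m : ℕ) :
    {x | prefixComplexity U x ≤ m}.Finite := by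
  have h := ENNReal.finite_const_le_of_tsum_ne_top
    (ne_top_of_le_ne_top ENNReal.one_ne_top hU.tsum_weight_prefixComplexity_le)
    (ε := weight m) (by simp [weight])
  exact h.subset fun x hx => weight_antitone hx

theorem isOrder_solovayAlpha (hU : IsOptimalPrefixFreeMachine U) : IsOrder (solovayAlpha U) := by
  refine ⟨monotone_solovayAlpha U, fun m => ?_⟩
  obtain ⟨N, hN⟩ := ((hU.finite_prefixComplexity_le m).image natOfStr).bddAbove
  obtain ⟨x, hx, he⟩ := exists_eq_solovayAlpha U N
  refine ⟨N, ?_⟩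
  rw [← he]
  by_contra h
  exact absurd (hN ⟨x, not_lt.1 h, rfl⟩) (not_le.2 hx)

theorem solovayAlpha_le_two_mul_length (hU : IsOptimalPrefixFreeMachine U) :
    ∃ c, ∀ x, solovayAlpha U (natOfStr x) ≤ 2 * x.length + c := by
  obtain ⟨c, hc⟩ := hU.prefixComplexity_le_two_mul_length
  refine ⟨2 + c, fun x => ?_⟩
  have h1 := hc (x ++ [false])
  have h2 : natOfStr x < natOfStr (x ++ [false]) := by
    rw [natOfStr_append]
    omega
  have h3 := solovayAlpha_le (U := U) h2
  rw [List.length_append, List.length_singleton] at h1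
  omega

theorem isSublinear_solovayAlpha (hU : IsOptimalPrefixFreeMachine U) :
    IsSublinear (solovayAlpha U) := by
  obtain ⟨c, hc⟩ := hU.solovayAlpha_le_two_mul_length
  refine Asymptotics.isLittleO_iff.2 fun ε hε => ?_
  obtain ⟨m, hm⟩ := exists_nat_gt ε⁻¹
  obtain ⟨N, hN⟩ := exists_mul_length_le m c
  filter_upwards [eventually_ge_atTop N] with n hn
  have h1 := hN (strOfNat n) (by rwa [natOfStr_strOfNat])
  have h2 := hc (strOfNat n)
  rw [natOfStr_strOfNat] at h1 h2
  have h3 : (m : ℝ) * solovayAlpha U n ≤ n := by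
    exact_mod_cast (Nat.mul_le_mul_left m h2).trans h1
  simp only [RCLike.norm_natCast]
  have h4 : 1 ≤ ε * m := by
    have := mul_le_mul_of_nonneg_left hm.le hε.le
    rwa [mul_inv_cancel₀ hε.ne'] at this
  have h5 : (0 : ℝ) ≤ solovayAlpha U n := Nat.cast_nonneg _
  nlinarith

/-- `α^*` is insensitive to partial computable functions, however fast these may grow: if
`z < g(x)`, then `α(z) ≤ K(g(x)) ≤ K(x) + O(1)`, which is below `x` for large `x`. -/
theorem starOp_solovayAlpha_le (hU : IsOptimalPrefixFreeMachine U) {g : List Bool →. List Bool}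
    (hg : Partrec g) :
    ∃ c, ∀ x y z, y ∈ g x → natOfStr z < natOfStr y →
      starOp (solovayAlpha U) (natOfStr z) ≤ starOp (solovayAlpha U) (natOfStr x) + c := by
  have hm := monotone_solovayAlpha U
  have hs := hU.isSublinear_solovayAlpha
  obtain ⟨c₁, h₁⟩ := hU.prefixComplexity_map_le hg
  obtain ⟨c₂, h₂⟩ := hU.prefixComplexity_le_two_mul_length
  obtain ⟨N, hN⟩ := exists_mul_length_le 1 (c₁ + c₂)
  refine ⟨starOp (solovayAlpha U) (2 * N + (c₁ + c₂)) + 1, fun x y z hxy hzy => ?_⟩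
  have hα : solovayAlpha U (natOfStr z) ≤ max (natOfStr x) (2 * N + (c₁ + c₂)) := by
    have k₁ := (solovayAlpha_le hzy).trans (h₁ x y hxy)
    have k₂ := h₂ x
    rcases le_total N (natOfStr x) with h | h
    · have k₃ := hN x h
      exact le_max_of_le_left (by omega)
    · have k₃ := length_le_natOfStr x
      exact le_max_of_le_right (by omega)
  have e₁ := starOp_le_succ hm hs (natOfStr z)
  have e₂ := starOp_mono hm hs hα
  have e₃ := starOp_max_le hm hs (natOfStr x) (2 * N + (c₁ + c₂))
  omega

/-! ### Upper semicomputability -/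

/-- A computable approximation from above of Solovay's function, decreasing in the stage `s`: the
bound `2 n + c` is improved by the lengths of the programs found to output strings beyond `n`. -/
def alphaStage (u : ℕ → List Bool → Option (List Bool)) (c s n : ℕ) : ℕ :=
  Nat.rec (2 * n + c) (fun i a => min (((Encodable.decode i : Option (ℕ × List Bool)).bind
    fun p => (u p.1 p.2).bind fun x => if n < natOfStr x then some p.2.length else none).getD a) a)
    s

theorem primrec_alphaStage {u : ℕ → List Bool → Option (List Bool)} (hu : Primrec₂ u) (c : ℕ) :
    Primrec₂ (alphaStage u c) := by
  have h : Primrec₂ fun (n : ℕ) (q : ℕ × ℕ) =>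
      min (((Encodable.decode q.1 : Option (ℕ × List Bool)).bind fun p =>
        (u p.1 p.2).bind fun x => if n < natOfStr x then some p.2.length else none).getD q.2)
        q.2 := by
    have ha : Primrec fun p : ℕ × ℕ × ℕ => p.2.2 := Primrec.snd.comp Primrec.snd
    refine Primrec.nat_min.comp (Primrec.option_getD.comp (Primrec.option_bind
      (Primrec.decode.comp (Primrec.fst.comp Primrec.snd)) ?_) ha) ha
    have hp : Primrec fun p : ((ℕ × ℕ × ℕ) × ℕ × List Bool) => p.2 := Primrec.snd
    refine Primrec.option_bind (hu.comp (Primrec.fst.comp hp) (Primrec.snd.comp hp)) ?_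
    refine Primrec.ite (Primrec.nat_lt.comp (Primrec.fst.comp (Primrec.fst.comp Primrec.fst))
      (primrec_natOfStr.comp Primrec.snd)) (Primrec.option_some.comp (Primrec.list_length.comp
      (Primrec.snd.comp (Primrec.snd.comp Primrec.fst)))) (Primrec.const none)
  exact (Primrec.nat_rec (Primrec.nat_add.comp Primrec.nat_double (Primrec.const c)) h).swap

theorem alphaStage_succ_le (u : ℕ → List Bool → Option (List Bool)) (c s n : ℕ) :
    alphaStage u c (s + 1) n ≤ alphaStage u c s n :=
  min_le_right _ _

theorem alphaStage_le_of_mem {u : ℕ → List Bool → Option (List Bool)} (c : ℕ) {n t : ℕ}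
    {x y : List Bool} (hx : x ∈ u t y) (hn : n < natOfStr x) :
    alphaStage u c (Encodable.encode (t, y) + 1) n ≤ y.length := by
  refine (min_le_left _ _).trans (le_of_eq ?_)
  rw [Encodable.encodek, Option.bind_some, Option.mem_def.1 hx, Option.bind_some, if_pos hn,
    Option.getD_some]

theorem solovayAlpha_le_alphaStage (hU : IsOptimalPrefixFreeMachine U)
    {u : ℕ → List Bool → Option (List Bool)} (hmem : ∀ y x, x ∈ U y ↔ ∃ s, x ∈ u s y) {c : ℕ}
    (hc : ∀ n, solovayAlpha U n ≤ 2 * n + c) (s n : ℕ) :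
    solovayAlpha U n ≤ alphaStage u c s n := by
  induction s with
  | zero => exact hc n
  | succ s ih =>
    refine le_min ?_ ih
    rcases ho : ((Encodable.decode s : Option (ℕ × List Bool)).bind fun p =>
      (u p.1 p.2).bind fun x => if n < natOfStr x then some p.2.length else none) with _ | l
    · exact ih
    · obtain ⟨p, -, hp⟩ := Option.bind_eq_some_iff.1 ho
      obtain ⟨x, hx, hl⟩ := Option.bind_eq_some_iff.1 hp
      rw [Option.ite_none_right_eq_some, Option.some_inj] at hl
      exact hl.2 ▸ (solovayAlpha_le hl.1).trans (hU.prefixComplexity_le ((hmem _ _).2 ⟨_, hx⟩))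

theorem exists_alphaStage_eq (hU : IsOptimalPrefixFreeMachine U)
    {u : ℕ → List Bool → Option (List Bool)} (hmem : ∀ y x, x ∈ U y ↔ ∃ s, x ∈ u s y) {c : ℕ}
    (hc : ∀ n, solovayAlpha U n ≤ 2 * n + c) (n : ℕ) :
    ∃ s, ∀ t, s ≤ t → alphaStage u c t n = solovayAlpha U n := by
  obtain ⟨x, hx, he⟩ := exists_eq_solovayAlpha U n
  obtain ⟨y, hy, hl⟩ := hU.exists_program x
  obtain ⟨s, hs⟩ := (hmem _ _).1 hy
  refine ⟨Encodable.encode (s, y) + 1, fun t ht => le_antisymm ?_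
    (solovayAlpha_le_alphaStage hU hmem hc t n)⟩
  rw [← he, ← hl]
  exact (antitone_nat_of_succ_le (f := fun s => alphaStage u c s n)
    (fun s => alphaStage_succ_le u c s n) ht).trans (alphaStage_le_of_mem c hs hx)

theorem iterate_solovayAlpha_le_iff (hU : IsOptimalPrefixFreeMachine U)
    {u : ℕ → List Bool → Option (List Bool)} (hmem : ∀ y x, x ∈ U y ↔ ∃ s, x ∈ u s y) {c : ℕ}
    (hc : ∀ n, solovayAlpha U n ≤ 2 * n + c) (k n m : ℕ) :
    (solovayAlpha U)^[k] n ≤ m ↔ ∃ s, (alphaStage u c s)^[k] n ≤ m := by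
  constructor
  · intro h
    have key : ∃ s, ∀ t, s ≤ t → (alphaStage u c t)^[k] n = (solovayAlpha U)^[k] n := by
      clear h
      induction k with
      | zero => exact ⟨0, fun _ _ => rfl⟩
      | succ k ih =>
        obtain ⟨s, hs⟩ := ih
        obtain ⟨r, hr⟩ := hU.exists_alphaStage_eq hmem hc ((solovayAlpha U)^[k] n)
        refine ⟨max s r, fun t ht => ?_⟩
        rw [Function.iterate_succ_apply', Function.iterate_succ_apply',
          hs t (le_of_max_le_left ht), hr t (le_of_max_le_right ht)]
    obtain ⟨s, hs⟩ := key
    exact ⟨s, (hs s le_rfl).trans_le h⟩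
  · rintro ⟨s, hs⟩
    exact ((monotone_solovayAlpha U).iterate_le_of_le
      (fun n => solovayAlpha_le_alphaStage hU hmem hc s n) k n).trans hs

theorem upperSemicomputable_slowedComplexity (hU : IsOptimalPrefixFreeMachine U) :
    UpperSemicomputable (slowedComplexity U) := by
  obtain ⟨u, hu, -, hmem⟩ := hU.partrec.exists_stages
  obtain ⟨c, hc⟩ := hU.solovayAlpha_le_two_mul_length
  have hc' : ∀ n, solovayAlpha U n ≤ 2 * n + c := by
    intro n
    have h1 := hc (strOfNat n)
    have h2 := length_le_natOfStr (strOfNat n)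
    rw [natOfStr_strOfNat] at h1 h2
    omega
  refine IsPrimrecProjection.rePred (.of_exists (β := (ℕ × ℕ) × (ℕ × List Bool))
    (q := fun a w => u w.2.1 w.2.2 = some a.1 ∧
      (alphaStage u c w.1.1)^[w.1.2] (natOfStr a.1) ≤ starThreshold (solovayAlpha U) ∧
      w.2.2.length + w.1.2 ≤ a.2) ?_ ?_)
  · have hx : Primrec fun p : (List Bool × ℕ) × ((ℕ × ℕ) × (ℕ × List Bool)) => p.1.1 :=
      Primrec.fst.comp Primrec.fst
    have hsk : Primrec fun p : (List Bool × ℕ) × ((ℕ × ℕ) × (ℕ × List Bool)) => p.2.1 :=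
      Primrec.fst.comp Primrec.snd
    have hty : Primrec fun p : (List Bool × ℕ) × ((ℕ × ℕ) × (ℕ × List Bool)) => p.2.2 :=
      Primrec.snd.comp Primrec.snd
    have hk := Primrec.snd.comp hsk
    have hy := Primrec.snd.comp hty
    refine PrimrecPred.and (Primrec.eq.comp (hu.comp (Primrec.fst.comp hty) hy)
      (Primrec.option_some.comp hx)) (PrimrecPred.and (Primrec.nat_le.comp
      (Primrec.nat_iterate hk (primrec_natOfStr.comp hx) ?_) (Primrec.const _))
      (Primrec.nat_le.comp (Primrec.nat_add.comp (Primrec.list_length.comp hy) hk)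
        (Primrec.snd.comp Primrec.fst)))
    exact (primrec_alphaStage hu c).comp (Primrec.fst.comp (hsk.comp Primrec.fst)) Primrec.snd
  · have hm := monotone_solovayAlpha U
    have hs := hU.isSublinear_solovayAlpha
    rintro ⟨x, r⟩
    constructor
    · intro h
      obtain ⟨y, hy, hl⟩ := hU.exists_program x
      obtain ⟨t, ht⟩ := (hmem _ _).1 hy
      obtain ⟨s, hs⟩ := (hU.iterate_solovayAlpha_le_iff hmem hc' _ _ _).1
        ((starOp_le_iff hm hs).1 (le_refl (starOp (solovayAlpha U) (natOfStr x))))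
      exact ⟨((s, _), (t, y)), ht, hs, hl ▸ h⟩
    · rintro ⟨⟨⟨s, k⟩, t, y⟩, h1, h2, h3⟩
      have h4 := hU.prefixComplexity_le ((hmem _ _).2 ⟨t, h1⟩)
      have h5 := (starOp_le_iff hm hs).2
        ((hU.iterate_solovayAlpha_le_iff hmem hc' _ _ _).2 ⟨s, h2⟩)
      exact (add_le_add h4 h5).trans h3

/-! ### The properties of `K + α^*` -/

theorem stable_slowedComplexity (hU : IsOptimalPrefixFreeMachine U) :
    StableUnderPartialComputable (slowedComplexity U) := by
  intro f hf
  obtain ⟨c₁, h₁⟩ := hU.prefixComplexity_map_le hf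
  -- appending a bit turns `f(x)` into a larger number
  have hg : Partrec fun x => (f x).map fun y => y ++ [false] :=
    hf.map (Primrec.list_append.comp Primrec.snd (Primrec.const [false])).to_comp.to₂
  obtain ⟨c₂, h₂⟩ := hU.starOp_solovayAlpha_le hg
  refine ⟨c₁ + c₂, fun x y hxy => ?_⟩
  have k₁ := h₁ x y hxy
  have k₂ := h₂ x _ y (Part.mem_map (fun y => y ++ [false]) hxy) (by rw [natOfStr_append]; omega)
  change prefixComplexity U y + starOp _ (natOfStr y) ≤
    prefixComplexity U x + starOp _ (natOfStr x) + _
  omega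

theorem summable_slowedComplexity (hU : IsOptimalPrefixFreeMachine U) :
    Summable (fun x : List Bool => (2 : ℝ) ^ (-(slowedComplexity U x : ℤ))) := by
  have h := ENNReal.summable_toReal
    (ne_top_of_le_ne_top ENNReal.one_ne_top hU.tsum_weight_prefixComplexity_le)
  refine Summable.of_nonneg_of_le (fun x => by positivity) (fun x => ?_) h
  rw [weight_toReal, inv_pow, ← zpow_natCast, ← zpow_neg]
  refine zpow_le_zpow_right₀ (by norm_num) (neg_le_neg ?_)
  exact_mod_cast Nat.le_add_right _ _

theorem primrec_replicate_false : Primrec fun n : ℕ => List.replicate n false := by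
  refine (Primrec.list_map Primrec.list_range
    (Primrec₂.const (α := ℕ) (β := ℕ) false)).of_eq fun n => ?_
  simp

theorem slowedComplexity_le_length_add (hU : IsOptimalPrefixFreeMachine U) :
    ∃ c : ℕ, ∀ x : List Bool, slowedComplexity U x
      ≤ x.length + slowedComplexity U (strEquivNat.symm x.length) + c := by
  obtain ⟨c₁, h₁⟩ := hU.prefixComplexity_le_length_add
  -- `n ↦ 0 ^ (n + 1)` computes from `n` a number beyond all strings of length `n`
  have hg : Partrec fun z : List Bool => Part.some (List.replicate (natOfStr z + 1) false) :=
    (primrec_replicate_false.comp (Primrec.succ.comp primrec_natOfStr)).to_comp.partrec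
  obtain ⟨c₂, h₂⟩ := hU.starOp_solovayAlpha_le hg
  refine ⟨c₁ + c₂, fun x => ?_⟩
  have hn : natOfStr (strEquivNat.symm x.length) = x.length := strEquivNat.apply_symm_apply _
  have k₁ := h₁ x
  have k₂ := h₂ (strEquivNat.symm x.length) _ x (Part.mem_some _) (by
    have e₁ := lt_two_pow_length x
    have e₂ := two_pow_length_le (List.replicate (x.length + 1) false)
    rw [List.length_replicate] at e₂
    rw [hn]
    omega)
  change prefixComplexity U x + starOp _ (natOfStr x) ≤
    x.length + (prefixComplexity U _ + starOp _ (natOfStr (strEquivNat.symm x.length))) + _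
  omega

theorem ncard_slowedComplexity_le (hU : IsOptimalPrefixFreeMachine U) :
    ∃ c : ℝ, ∀ (n : ℕ) (b : ℤ),
      (Set.ncard {x : List Bool | x.length = n ∧
        (slowedComplexity U x : ℤ)
          ≤ (n : ℤ) + (slowedComplexity U (strEquivNat.symm n) : ℤ) - b} : ℝ)
        ≤ c * (2 : ℝ) ^ ((n : ℤ) - b) := by
  obtain ⟨c, hc⟩ := hU.ncard_mul_two_pow_le
  refine ⟨2 ^ c, fun n b => ?_⟩
  set m := prefixComplexity U (strEquivNat.symm n)
  -- as `α^*` is monotone, passing from `A` to `K` only enlarges the set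
  have hK : ∀ x : List Bool, x.length = n → (slowedComplexity U x : ℤ)
      ≤ (n : ℤ) + (slowedComplexity U (strEquivNat.symm n) : ℤ) - b →
      (prefixComplexity U x : ℤ) ≤ n + m - b := by
    rintro x hx h
    have h1 := starOp_mono (monotone_solovayAlpha U) hU.isSublinear_solovayAlpha
      (length_le_natOfStr x)
    rw [hx] at h1
    have h2 : slowedComplexity U (strEquivNat.symm n) = m + starOp (solovayAlpha U) n := by
      rw [slowedComplexity, Equiv.apply_symm_apply]
    have h3 : slowedComplexity U x =
      prefixComplexity U x + starOp (solovayAlpha U) (natOfStr x) := rfl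
    omega
  rcases lt_or_ge ((n : ℤ) + m - b) 0 with hneg | hpos
  · rw [Set.eq_empty_of_forall_notMem (s := {x : List Bool | x.length = n ∧ _}) fun x hx => by
      have := hK x hx.1 hx.2
      omega]
    simp only [Set.ncard_empty, Nat.cast_zero]
    positivity
  · obtain ⟨k, hk⟩ := Int.eq_ofNat_of_zero_le hpos
    have hfin : {x : List Bool | x.length = n ∧ prefixComplexity U x ≤ k}.Finite :=
      (List.finite_length_eq Bool n).subset fun x hx => hx.1
    have hle := Set.ncard_le_ncard (fun x hx => ⟨hx.1, by have := hK x hx.1 hx.2; omega⟩ :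
      {x : List Bool | x.length = n ∧ (slowedComplexity U x : ℤ)
        ≤ (n : ℤ) + (slowedComplexity U (strEquivNat.symm n) : ℤ) - b} ⊆
      {x : List Bool | x.length = n ∧ prefixComplexity U x ≤ k}) hfin
    refine (Nat.cast_le.2 hle).trans ?_
    have h := hc n k
    have h' : ({x : List Bool | x.length = n ∧ prefixComplexity U x ≤ k}.ncard : ℝ) * 2 ^ m ≤
        2 ^ (k + c) := by exact_mod_cast h
    refine le_of_mul_le_mul_right (h'.trans (le_of_eq ?_)) (by positivity : (0 : ℝ) < 2 ^ m)
    have e : ((n : ℤ) - b) + m = k := by omega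
    rw [mul_assoc, ← zpow_natCast (2 : ℝ) m, ← zpow_add₀ (by norm_num), e, zpow_natCast,
      ← pow_add, add_comm]

theorem not_bounded_slowedComplexity (hU : IsOptimalPrefixFreeMachine U) :
    ¬ ∃ c : ℤ, ∀ x : List Bool,
      |(slowedComplexity U x : ℤ) - (prefixComplexity U x : ℤ)| ≤ c := by
  rintro ⟨c, hc⟩
  obtain ⟨n, hn⟩ := exists_lt_starOp hU.isOrder_solovayAlpha hU.isSublinear_solovayAlpha c.toNat
  have h := (le_abs_self _).trans (hc (strEquivNat.symm n))
  rw [slowedComplexity, Equiv.apply_symm_apply] at h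
  omega

end IsOptimalPrefixFreeMachine

end

theorem theorem3 (U : List Bool →. List Bool) (hU : IsOptimalPrefixFreeMachine U) :
    -- `α` is a sub-linear order, so that the star-operator applies to it
    (IsOrder (solovayAlpha U) ∧ IsSublinear (solovayAlpha U)) ∧
    UpperSemicomputable (slowedComplexity U) ∧
    StableUnderPartialComputable (slowedComplexity U) ∧
    Summable (fun x : List Bool => (2 : ℝ) ^ (-(slowedComplexity U x : ℤ))) ∧
    (∃ c : ℕ, ∀ x : List Bool,
      slowedComplexity U x
        ≤ x.length + slowedComplexity U (strEquivNat.symm x.length) + c) ∧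
    (∃ c : ℝ, ∀ (n : ℕ) (b : ℤ),
      (Set.ncard {x : List Bool | x.length = n ∧
        (slowedComplexity U x : ℤ)
          ≤ (n : ℤ) + (slowedComplexity U (strEquivNat.symm n) : ℤ) - b} : ℝ)
        ≤ c * (2 : ℝ) ^ ((n : ℤ) - b)) ∧
    ¬ ∃ c : ℤ, ∀ x : List Bool,
      |(slowedComplexity U x : ℤ) - (prefixComplexity U x : ℤ)| ≤ c :=
  ⟨⟨hU.isOrder_solovayAlpha, hU.isSublinear_solovayAlpha⟩,
    hU.upperSemicomputable_slowedComplexity, hU.stable_slowedComplexity,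
    hU.summable_slowedComplexity, hU.slowedComplexity_le_length_add,
    hU.ncard_slowedComplexity_le, hU.not_bounded_slowedComplexity⟩
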